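/- Let $k\ge 0$ and let $\Sigma_k=\{0,1,\ldots,k-1\}$. For a word $u=xy$ over $\Sigma_k$ with $|x|=i$, write $\sigma^i(u)=yx$. For integers $n>i\ge 1$, let $H(n,i)$ be the set of words $u$ of length $n$ over $\Sigma_k$ such that $u$ and $\sigma^i(u)$ differ in exactly $2$ positions, let $H''(n,i)$ be the set of words in $H(n,i)$ that are not in $H(n,j)$ for any $1\le j<i$, and let $h''(n,i)=|H''(n,i)|$. Let $p_k(i)$ be the number of words of length $i$ over $\Sigma_k$ that are not primitive, that is, that have the form $z^m$ for some word $z$ and some integer $m\ge 2$. Let $n,i$ be positive integers such that $n\ge 2i$. Then \[h''(n,i)=\begin{cases} \frac12\, n(k-1)\Big(k^{\gcd(n,i)}\Big(\frac{n}{\gcd(n,i)}-1\Big)-2p_k(i)\Big), & \text{if } i\mid n;\\[1ex] \frac12\, k^{\gcd(n,i)}(k-1)\,n\Big(\frac{n}{\gcd(n,i)}-3\Big), & \text{otherwise.} \end{cases}\] -/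

import Mathlib

/-- Words of length `n` over the alphabet `Σ_k = {0, 1, …, k - 1}`. -/
abbrev Word (k n : ℕ) : Type := Fin n → Fin k

namespace Word

variable {k n : ℕ}

/-- The `i`-fold left shift `σ^i`: if `u = xy` with `|x| = i`, then `shift i u = yx`,
that is, the letter of `shift i u` at position `t` is the letter of `u` at position
`(t + i) mod n`. -/
def shift (i : ℕ) (u : Word k n) : Word k n :=
  fun t => u ⟨(t.val + i) % n, Nat.mod_lt _ (Nat.lt_of_le_of_lt (Nat.zero_le _) t.isLt)⟩

/-- A word `w` is a power if `w = z^m` for some word `z` and some `m ≥ 2`. -/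
def IsPower (w : Word k n) : Prop :=
  ∃ (m d : ℕ) (h : n = m * d) (z : Word k d), 2 ≤ m ∧ w = Fin.repeat m z ∘ Fin.cast h

/-- A word is primitive if it is not a power. -/
def IsPrimitive (w : Word k n) : Prop := ¬ w.IsPower

end Word

/-- `p_k(n)`: the number of non-primitive words of length `n` over `Σ_k`. -/
noncomputable def numNonprimitive (k n : ℕ) : ℕ :=
  {w : Word k n | ¬ w.IsPrimitive}.ncard

/-- `H(n, i)`: the words `u` of length `n` over `Σ_k` whose Hamming distance to
`σ^i(u)` is `2`. -/
def setH (k n i : ℕ) : Set (Word k n) :=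
  {u | hammingDist u (u.shift i) = 2}

/-- `H''(n, i)`: the words in `H(n, i)` that are in no `H(n, j)` with `1 ≤ j < i`. -/
def setH'' (k n i : ℕ) : Set (Word k n) :=
  {w | w ∈ setH k n i ∧ ∀ j : ℕ, 1 ≤ j → j < i → w ∉ setH k n j}

/-- `h''(n, i)`, the cardinality of `H''(n, i)`. -/
noncomputable def numH'' (k n i : ℕ) : ℕ := (setH'' k n i).ncard

/-! View words as functions on `ZMod n`, and call `t` a jump of `u` along `c` if `u (t + c) ≠ u t`.
Write g = gcd(n, i).

A word with exactly two jumps along i, one of them marked as `a`, is in a unique way an i-periodic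
word plus a nonzero constant on an arc a + i, …, a + (m + 1)i. The arc has between 1 and n/g - 1
points, so twice the number of such words is n(n/g - 1)k^g(k - 1) (`two_mul_card_two_jumps`).

Discard those that also have two jumps along some j < i. Comparing the mixed second differences
shows that both pairs of jumps come from a single changed letter in a word with periods i and j
(`exists_periodic_of_two_jumps`), hence with period gcd(n, i, j), a proper divisor of i. Conversely,
every such change gives two jumps along i and along the smaller period. The periodic word, the
position and the change are recoverable (`add_single_injective`), so each word with such a period
accounts for n(k - 1) discarded words.

If i ∣ n, these periodic words correspond to the non-primitive words of length i. Otherwise g < i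
and they are all k^g words of period i, which turns n/g - 1 into n/g - 3. -/

open Finset Function

/-- The number of positions at which `u` differs from its translate by `c`. -/
abbrev numJumps {G A : Type*} [Fintype G] [Add G] [DecidableEq A] (u : G → A) (c : G) : ℕ :=
  #{t | u (t + c) ≠ u t}

theorem succ_nsmul_ne_zero_of_lt_addOrderOf {G : Type*} [AddMonoid G] {i : G} {m : ℕ}
    (hm : m < addOrderOf i - 1) :
    (m + 1) • i ≠ 0 := by
  intro h
  have := Nat.le_of_dvd (Nat.succ_pos m) (addOrderOf_dvd_of_nsmul_eq_zero h)
  omega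

/-! ### Single-letter changes and arcs -/

section Translate

variable {G A : Type*} [AddCommGroup G] [DecidableEq G]

/-- If `p ≠ p'`, then `w` and `w'` agree off these two points but differ at `p`. Translation by `i`
forces `p' = p + i`; translations by `d` and `d'` then lead from `p` through points where the words
agree, a contradiction. -/
theorem add_single_injective [AddCommGroup A] {w w' : G → A} {p p' : G}
    {x x' : A} {i d d' : G} (hi : i ≠ 0) (hd : d ≠ 0) (hdi : d ≠ i) (hd' : d' ≠ 0) (hdi' : d' ≠ i)
    (hdd : d = d' ∨ d + d' ≠ 0 ∧ d + d' ≠ i) (hwi : Periodic w i) (hwi' : Periodic w' i)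
    (hw : Periodic w d) (hw' : Periodic w' d') (hx : x ≠ 0)
    (h : w + Pi.single p x = w' + Pi.single p' x') : w = w' ∧ p = p' ∧ x = x' := by
  have off : ∀ t, t ≠ p → t ≠ p' → w t = w' t := fun t h1 h2 => by
    simpa [h1, h2] using congrFun h t
  have hp : p = p' := by
    by_contra hp
    have hwp : w p ≠ w' p := fun h1 => by
      have := congrFun h p
      simp [hp, h1, hx] at this
    have hpi : p' = p + i := by
      by_contra h1
      apply hwp
      rw [← hwi, ← hwi', off _ (by simpa using hi) (Ne.symm h1)]
    subst hpi
    have off' : ∀ s, s ≠ 0 → s ≠ i → w (p + s) = w' (p + s) := fun s h1 h2 =>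
      off _ (by simpa using h1) (by simpa using h2)
    apply hwp
    rcases hdd with rfl | ⟨h1, h2⟩
    · rw [← hw, ← hw', off' _ hd hdi]
    -- The path visits `p + d'`, `p + d + d'` and `p + d`, all distinct from `p` and `p + i`.
    · rw [← hw' p, ← off' _ hd' hdi', ← hw (p + d'), add_assoc, add_comm d', off' _ h1 h2,
        ← add_assoc, hw', ← off' _ hd hdi, hw]
  subst hp
  have hwp : w = w' := by
    funext t
    by_cases h1 : t = p
    · subst h1
      rw [← hwi, ← hwi', off _ (by simpa using hi) (by simpa using hi)]
    · exact off t h1 h1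
  subst hwp
  exact ⟨rfl, rfl, Pi.single_injective p (add_left_cancel h)⟩

/-- The function with value `c` on `a + i, a + 2i, …, a + (m + 1)i` (with multiplicity). -/
def arcBump [AddCommGroup A] (i a : G) (m : ℕ) (c : A) : G → A :=
  fun t => ∑ s ∈ range (m + 1), if t = a + (s + 1) • i then c else 0

theorem arcBump_translate_sub [AddCommGroup A] (i a : G) (m : ℕ) (c : A) (t : G) :
    arcBump i a m c (t + i) - arcBump i a m c t =
      (if t = a then c else 0) - (if t = a + (m + 1) • i then c else 0) := by
  have h : ∀ s : ℕ, (t + i = a + (s + 1) • i) = (t = a + s • i) := fun s => by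
    rw [succ_nsmul, ← add_assoc, add_left_inj]
  simp only [arcBump, h]
  rw [← sum_sub_distrib]
  have := sum_range_sub' (fun s : ℕ => if t = a + s • i then c else 0) (m + 1)
  simpa using this

end Translate

/-! ### Functions with two jumps on a finite abelian group -/

section Generic

variable {G A : Type*} [AddCommGroup G] [Fintype G]

theorem sum_translate_sub {B : Type*} [AddCommGroup B] (f : G → B) (i : G) :
    ∑ t, (f (t + i) - f t) = 0 := by
  rw [sum_sub_distrib, sub_eq_zero]
  exact Fintype.sum_equiv (Equiv.addRight i) _ _ fun _ => rfl

variable [DecidableEq G]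

/-- If `u` has exactly two jumps, the differences there are opposite. -/
theorem translate_sub_eq {B : Type*} [AddCommGroup B] (f : G → B) {i a b : G} (hab : a ≠ b)
    (h : ∀ t, f (t + i) ≠ f t → t = a ∨ t = b) (t : G) :
    f (t + i) - f t = (if t = a then f (a + i) - f a else 0)
      - (if t = b then f (a + i) - f a else 0) := by
  have hs := sum_translate_sub f i
  rw [← sum_subset (subset_univ {a, b}), sum_pair hab] at hs
  · by_cases h1 : t = a
    · subst h1; simp [hab]
    · by_cases h2 : t = b
      · subst h2
        simp only [h1, if_false, if_true, zero_sub]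
        exact eq_neg_of_add_eq_zero_right hs
      · have : f (t + i) = f t := by
          by_contra h3
          exact (h t h3).elim h1 h2
        simp [h1, h2, this]
  · intro t _ ht
    by_contra h3
    apply ht
    simpa using h t (fun h4 => h3 (by rw [h4, sub_self]))

theorem numJumps_eq_two_iff [DecidableEq A] {u : G → A} {c : G} :
    numJumps u c = 2 ↔ ∃ a b, a ≠ b ∧ ∀ t, u (t + c) ≠ u t ↔ t = a ∨ t = b := by
  simp only [numJumps, card_eq_two, Finset.ext_iff, mem_filter, mem_univ, true_and, mem_insert,
    mem_singleton]

/-- The difference operators along `i` and `j` commute, so l(δ_{a-j} + δ_b - δ_a - δ_{b-j}) =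
m(δ_{c-i} + δ_d - δ_c - δ_{d-i}). Since `l` and `m` are positive, signs can be compared pointwise,
and the nonvanishing hypotheses leave only the configurations with a common point `p`. -/
theorem exists_periodic_of_two_jumps_int {f : G → ℤ} {i j a b c d : G}
    (hj : j ≠ 0) (hij : i ≠ j) (hjj : j + j ≠ 0) (hs : i + j ≠ 0)
    (hab : a ≠ b) (hI : ∀ t, f (t + i) ≠ f t ↔ t = a ∨ t = b)
    (hcd : c ≠ d) (hJ : ∀ t, f (t + j) ≠ f t ↔ t = c ∨ t = d)
    (hl : 0 < f (a + i) - f a) (hm : 0 < f (c + j) - f c) :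
    ∃ p, (∀ t, f (t + i) ≠ f t ↔ t = p ∨ t + i = p) ∧
      (∀ t, f (t + j) ≠ f t ↔ t = p ∨ t + j = p) := by
  have eI := translate_sub_eq f hab fun t => (hI t).1
  have eJ := translate_sub_eq f hcd fun t => (hJ t).1
  set l := f (a + i) - f a
  set m := f (c + j) - f c
  have key : ∀ t, ((if t + j = a then l else 0) - (if t + j = b then l else 0))
      - ((if t = a then l else 0) - (if t = b then l else 0)) =
      ((if t + i = c then m else 0) - (if t + i = d then m else 0))
      - ((if t = c then m else 0) - (if t = d then m else 0)) := by
    intro t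
    rw [← eI, ← eI, ← eJ, ← eJ, add_right_comm t j i]
    ring
  have nonneg (P : Prop) [Decidable P] : 0 ≤ if P then m else 0 := by split_ifs <;> omega
  have nonneg' (P : Prop) [Decidable P] : 0 ≤ if P then l else 0 := by split_ifs <;> omega
  have pos : ∀ t, t + j = a ∨ t = b → t + i = c ∨ t = d := by
    intro t ht
    by_contra! hc
    have h := key t
    rw [if_neg hc.1, if_neg hc.2] at h
    have m1 := nonneg (t + i = d)
    have m2 := nonneg (t = c)
    rcases ht with rfl | rfl
    · rw [if_pos rfl, if_neg hab, if_neg (by simpa using hj)] at h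
      have := nonneg' (t = b)
      omega
    · rw [if_pos (Eq.refl t), if_neg hab.symm, if_neg (show ¬ t + j = t by simpa using hj)] at h
      have := nonneg' (t + j = a)
      omega
  have neg : ∀ t, t = a ∨ t + j = b → t = c ∨ t + i = d := by
    intro t ht
    by_contra! hc
    have h := key t
    rw [if_neg hc.1, if_neg hc.2] at h
    have m1 := nonneg (t + i = c)
    have m2 := nonneg (t = d)
    rcases ht with rfl | rfl
    · rw [if_pos (Eq.refl t), if_neg hab, if_neg (show ¬ t + j = t by simpa using hj)] at h
      have := nonneg' (t + j = b)
      omega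
    · rw [if_pos rfl, if_neg hab.symm, if_neg (show ¬ t = t + j by simpa using hj)] at h
      have := nonneg' (t = a)
      omega
  have ha := neg a (Or.inl rfl)
  have hb := pos b (Or.inr rfl)
  have haj := pos (a - j) (Or.inl (by abel))
  have hbj := neg (b - j) (Or.inr (by abel))
  rcases ha with rfl | rfl
  · rcases haj with h | h
    · exact absurd (by simpa [sub_add_eq_add_sub, sub_eq_iff_eq_add] using h) hij
    · have hb' : b + i = a := by
        rcases hb with h2 | h2
        · exact h2
        · subst h2
          rw [← h] at hbj
          rcases hbj with h3 | h3
          · exact absurd (by linear_combination (norm := abel) -h3) hjj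
          · exact absurd (by linear_combination (norm := abel) h3) hij
      refine ⟨a, fun t => ?_, fun t => ?_⟩
      · rw [hI, ← hb', add_left_inj]
      · rw [hJ, ← h, eq_sub_iff_add_eq]
  · rcases haj with h | h
    · have hb' : b = a + i := by
        rcases hb with h2 | h2
        · exfalso
          have : b = a - j := by rw [← add_left_inj i, h2, h]
          subst this
          rcases hbj with h3 | h3
          · exact hs (by linear_combination (norm := abel) h - h3)
          · exact hjj (by linear_combination (norm := abel) -h3)
        · exact h2
      refine ⟨a + i, fun t => ?_, fun t => ?_⟩
      · rw [hI, hb', add_left_inj, or_comm]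
      · rw [hJ, ← h, or_comm]
        refine or_congr Iff.rfl ⟨fun h => ?_, fun h => ?_⟩
        · rw [h]; abel
        · rw [← sub_eq_iff_eq_add.2 h.symm]; abel
    · exact absurd (by linear_combination (norm := abel) -h) hs

theorem exists_oriented_jumps {f : G → ℤ} {i : G} (h : numJumps f i = 2) :
    ∃ a b, a ≠ b ∧ (∀ t, f (t + i) ≠ f t ↔ t = a ∨ t = b) ∧ 0 < f (a + i) - f a := by
  obtain ⟨a, b, hab, hI⟩ := numJumps_eq_two_iff.1 h
  have hb := translate_sub_eq f hab (fun t => (hI t).1) b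
  rw [if_neg hab.symm, if_pos rfl, zero_sub] at hb
  have ha := (hI a).2 (Or.inl rfl)
  rcases lt_or_gt_of_ne ha with h1 | h1
  · exact ⟨b, a, hab.symm, fun t => (hI t).trans or_comm, by omega⟩
  · exact ⟨a, b, hab, hI, by omega⟩

/-- A function with two jumps along each of `i` and `j` is obtained from a function with periods
`i` and `j` by changing one value. -/
theorem exists_periodic_of_two_jumps [AddCommGroup A] [Fintype A] [DecidableEq A] {u : G → A}
    {i j : G} (hi : i ≠ 0) (hj : j ≠ 0) (hij : i ≠ j) (hjj : j + j ≠ 0) (hs : i + j ≠ 0)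
    (hI : numJumps u i = 2) (hJ : numJumps u j = 2) :
    ∃ (w : G → A) (p : G) (c : A), c ≠ 0 ∧ Periodic w i ∧ Periodic w j ∧
      u = w + Pi.single p c := by
  -- Jumps depend only on equality of letters, so the alphabet may be embedded in ℤ, where signs are
  -- available.
  let φ : A → ℤ := fun x => (Fintype.equivFin A x : ℕ)
  have hφ : Injective φ := fun x y h => by
    simpa [φ, Fin.val_inj] using h
  have hn : ∀ c, numJumps (φ ∘ u) c = numJumps u c := fun c => by
    simp only [numJumps, comp_apply, hφ.ne_iff]
  obtain ⟨a, b, hab, hI', hl⟩ := exists_oriented_jumps ((hn i).trans hI)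
  obtain ⟨c, d, hcd, hJ', hm⟩ := exists_oriented_jumps ((hn j).trans hJ)
  obtain ⟨p, h1, h2⟩ := exists_periodic_of_two_jumps_int hj hij hjj hs hab hI' hcd hJ' hl hm
  simp only [comp_apply, hφ.ne_iff] at h1 h2
  have s1 := translate_sub_eq u (i := i) (a := p) (b := p - i) (Ne.symm (by simpa using hi))
    (fun t ht => by simpa [eq_sub_iff_add_eq] using (h1 t).1 ht) (p - i)
  have s2 := translate_sub_eq u (i := j) (a := p) (b := p - j) (Ne.symm (by simpa using hj))
    (fun t ht => by simpa [eq_sub_iff_add_eq] using (h2 t).1 ht) (p - j)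
  have e1 : u (p + i) = u (p - i) := by
    simp only [sub_add_cancel, sub_eq_self, hi, if_false, if_true, zero_sub, neg_sub] at s1
    simpa using s1.symm
  have e2 : u (p + j) = u (p - j) := by
    simp only [sub_add_cancel, sub_eq_self, hj, if_false, if_true, zero_sub, neg_sub] at s2
    simpa using s2.symm
  -- Neither `p + i` is a jump along `j` nor `p + j` one along `i`, so both letters equal the one at
  -- `p + i + j`. This is the letter to restore at `p`.
  have e3 : u (p + j) = u (p + i) := by
    have h3 : u (p + i + j) = u (p + i) := by
      by_contra h
      rcases (h2 _).1 h with h | h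
      · exact hi (by simpa using h)
      · exact hs (by simpa [add_assoc] using h)
    have h4 : u (p + j + i) = u (p + j) := by
      by_contra h
      rcases (h1 _).1 h with h | h
      · exact hj (by simpa using h)
      · exact hs (by simpa [add_assoc, add_comm j i] using h)
    rw [← h3, ← h4, add_right_comm]
  have per : ∀ c, c ≠ 0 → (∀ t, u (t + c) ≠ u t ↔ t = p ∨ t + c = p) →
      u (p + c) = u (p + i) → u (p - c) = u (p + i) →
      Periodic (Function.update u p (u (p + i))) c := by
    intro c hc h hp hq t
    by_cases h5 : t = p
    · subst h5
      rw [update_self, update_of_ne (by simpa using hc), hp]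
    · by_cases h6 : t + c = p
      · rw [h6, update_self, update_of_ne h5, ← hq, ← h6, add_sub_cancel_right]
      · rw [update_of_ne h5, update_of_ne h6]
        by_contra h7
        exact ((h t).1 h7).elim h5 h6
  refine ⟨_, p, u p - u (p + i), ?_, per i hi h1 rfl e1.symm, per j hj h2 e3 (e2.symm.trans e3), ?_⟩
  · rw [sub_ne_zero]
    exact ((h1 p).2 (Or.inl rfl)).symm
  · funext t
    by_cases h5 : t = p
    · subst h5; simp
    · simp [h5]

/-- Changing one value of a function of period `c` creates exactly two jumps along `c`. -/
theorem numJumps_add_single [AddCommGroup A] [DecidableEq A] {w : G → A} {c : G} (hc : c ≠ 0)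
    (hw : Periodic w c) (p : G) {x : A} (hx : x ≠ 0) :
    numJumps (w + Pi.single p x) c = 2 := by
  refine numJumps_eq_two_iff.2 ⟨p, p - c, Ne.symm (by simpa using hc), fun t => ?_⟩
  rw [Pi.add_apply, Pi.add_apply, hw, Ne, add_right_inj, Pi.single_apply, Pi.single_apply,
    eq_sub_iff_add_eq]
  by_cases h1 : t = p
  · subst h1
    simp [hc, hx.symm]
  · simp [h1, hx]

/-- Twice the number of functions with exactly two jumps along `i`. -/
theorem two_mul_card_two_jumps [AddCommGroup A] [Fintype A] [DecidableEq A] (i : G)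
    [DecidablePred fun w : G → A => Periodic w i] :
    2 * #{u : G → A | numJumps u i = 2} =
      Fintype.card G * ((addOrderOf i - 1) *
        (#{w : G → A | Periodic w i} * (Fintype.card A - 1))) := by
  -- Marking a jump counts each word twice and fixes the start of the arc.
  have hT : #(({u | numJumps u i = 2} : Finset (G → A)).sigma fun u => {t | u (t + i) ≠ u t}) =
      2 * #{u : G → A | numJumps u i = 2} := by
    rw [card_sigma, sum_congr rfl (fun u hu => (mem_filter.1 hu).2), sum_const, smul_eq_mul,
      mul_comm]
  have hS : #((univ : Finset G) ×ˢ range (addOrderOf i - 1) ×ˢ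
      ({w : G → A | Periodic w i} : Finset (G → A)) ×ˢ (univ.erase (0 : A))) =
      Fintype.card G * ((addOrderOf i - 1) *
        (#{w : G → A | Periodic w i} * (Fintype.card A - 1))) := by
    simp only [card_product, card_univ, card_range, card_erase_of_mem (mem_univ _)]
  rw [← hT, ← hS]
  have jump : ∀ (a : G) (m : ℕ) (w : G → A) (c : A), Periodic w i → ∀ t,
      (w + arcBump i a m c) (t + i) - (w + arcBump i a m c) t =
      (if t = a then c else 0) - (if t = a + (m + 1) • i then c else 0) := by
    intro a m w c hw t
    rw [← arcBump_translate_sub, Pi.add_apply, Pi.add_apply, hw]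
    abel
  symm
  refine card_bij (fun x _ => ⟨x.2.2.1 + arcBump i x.1 x.2.1 x.2.2.2, x.1⟩) ?_ ?_ ?_
  · rintro ⟨a, m, w, c⟩ h
    simp only [mem_product, mem_univ, mem_range, mem_filter, mem_erase, true_and, and_true] at h
    obtain ⟨hm, hw, hc⟩ := h
    have hb := succ_nsmul_ne_zero_of_lt_addOrderOf hm
    have hD : ∀ t, (w + arcBump i a m c) (t + i) ≠ (w + arcBump i a m c) t ↔
        t = a ∨ t = a + (m + 1) • i := by
      intro t
      rw [← sub_ne_zero, jump a m w c hw]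
      by_cases h1 : t = a
      · subst h1
        simp [hb, hc]
      · simp [h1, hc]
    simp only [mem_sigma, mem_filter, mem_univ, true_and]
    exact ⟨numJumps_eq_two_iff.2 ⟨a, _, by simpa using hb, hD⟩, (hD a).2 (Or.inl rfl)⟩
  · rintro ⟨a, m, w, c⟩ h ⟨a', m', w', c'⟩ h' heq
    simp only [mem_product, mem_univ, mem_range, mem_filter, mem_erase, true_and, and_true] at h h'
    obtain ⟨hm, hw, hc⟩ := h
    obtain ⟨hm', hw', hc'⟩ := h'
    simp only [Sigma.mk.injEq, heq_eq_eq] at heq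
    obtain ⟨heq, rfl⟩ := heq
    have hb := succ_nsmul_ne_zero_of_lt_addOrderOf hm
    have hb' := succ_nsmul_ne_zero_of_lt_addOrderOf hm'
    have hj : ∀ t, _ := fun t => (jump a m w c hw t).symm.trans
      ((congrArg (fun f : G → A => f (t + i) - f t) heq).trans (jump a m' w' c' hw' t))
    have hcc : c = c' := by simpa [hb, hb'] using hj a
    subst hcc
    have hmm : m = m' := by
      have h1 : (m + 1) • i = (m' + 1) • i := by
        by_contra h1
        have := hj (a + (m + 1) • i)
        simp [hb, h1, hc] at this
      have := nsmul_injOn_Iio_addOrderOf (x := i) (show m + 1 ∈ Set.Iio (addOrderOf i) from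
        (by rw [Set.mem_Iio]; omega)) (show m' + 1 ∈ Set.Iio (addOrderOf i) from
        (by rw [Set.mem_Iio]; omega)) h1
      omega
    subst hmm
    rw [add_right_cancel heq]
  · rintro ⟨u, a⟩ h
    simp only [mem_sigma, mem_filter, mem_univ, true_and] at h
    obtain ⟨h2, ha⟩ := h
    obtain ⟨b, hab, hD⟩ : ∃ b, a ≠ b ∧ ∀ t, u (t + i) ≠ u t ↔ t = a ∨ t = b := by
      obtain ⟨x, y, hxy, hD⟩ := numJumps_eq_two_iff.1 h2
      rcases (hD a).1 ha with rfl | rfl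
      · exact ⟨y, hxy, hD⟩
      · exact ⟨x, hxy.symm, fun t => (hD t).trans or_comm⟩
    obtain ⟨m, hm, rfl⟩ : ∃ m < addOrderOf i - 1, b = a + (m + 1) • i := by
      by_contra! hno
      have hpos := addOrderOf_pos i
      -- With no second jump on the orbit of `a`, `u` is constant from `a + i` all the way round to
      -- `a`, so `a` is not a jump.
      have prop : ∀ s ≤ addOrderOf i - 1, u (a + (s + 1) • i) = u (a + i) := by
        intro s
        induction s with
        | zero => simp
        | succ s ih =>
          intro hs
          rw [← ih (by omega)]
          by_contra h3
          rw [succ_nsmul _ (s + 1), ← add_assoc] at h3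
          rcases (hD _).1 h3 with h4 | h4
          · exact succ_nsmul_ne_zero_of_lt_addOrderOf (i := i) (m := s) (by omega) (by simpa using h4)
          · exact hno s (by omega) h4.symm
      have := prop _ le_rfl
      rw [Nat.sub_add_cancel hpos, addOrderOf_nsmul_eq_zero, add_zero] at this
      exact ha this.symm
    refine ⟨(a, m, u - arcBump i a m (u (a + i) - u a), u (a + i) - u a), ?_, ?_⟩
    · simp only [mem_product, mem_univ, mem_range, mem_filter, mem_erase, true_and, and_true]
      refine ⟨hm, fun t => ?_, sub_ne_zero.2 ha⟩
      have h3 := translate_sub_eq u hab (fun t => (hD t).1) t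
      rw [← arcBump_translate_sub] at h3
      rw [Pi.sub_apply, Pi.sub_apply, sub_eq_sub_iff_sub_eq_sub, h3]
    · simp

end Generic

/-! ### Periods on `ZMod n` and the words to discard -/

section Cyclic

variable {n : ℕ} {A : Type*}

theorem ZMod.natCast_ne_zero_of_lt {m : ℕ} (h0 : 0 < m) (hm : m < n) : (m : ZMod n) ≠ 0 := by
  rw [Ne, ZMod.natCast_eq_zero_iff]
  exact fun h => absurd (Nat.le_of_dvd h0 h) (by omega)

theorem periodic_natCast_of_dvd {w : ZMod n → A} {d i : ℕ} (h : d ∣ i)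
    (hw : Periodic w (d : ZMod n)) : Periodic w (i : ZMod n) := by
  obtain ⟨q, rfl⟩ := h
  have := hw.nsmul q
  rwa [nsmul_eq_mul, mul_comm, ← Nat.cast_mul] at this

theorem periodic_gcd {B : Type*} [CommRing B] {w : B → A} {i j : ℕ}
    (hi : Periodic w (i : B)) (hj : Periodic w (j : B)) : Periodic w (Nat.gcd i j : B) := by
  have h : ((Nat.gcd i j : ℕ) : B) = Nat.gcdA i j • (i : B) + Nat.gcdB i j • (j : B) := by
    have h1 := congrArg (Int.cast : ℤ → B) (Nat.gcd_eq_gcd_ab i j)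
    push_cast at h1
    rw [h1, zsmul_eq_mul, zsmul_eq_mul, mul_comm (i : B), mul_comm (j : B)]
  rw [h]
  exact (hi.zsmul _).add_period (hj.zsmul _)

theorem periodic_natCast_self (w : ZMod n → A) : Periodic w (n : ZMod n) := by
  intro t; simp

theorem periodic_gcd_iff {w : ZMod n → A} {i : ℕ} :
    Periodic w (i : ZMod n) ↔ Periodic w (Nat.gcd n i : ZMod n) :=
  ⟨periodic_gcd (periodic_natCast_self w), periodic_natCast_of_dvd (Nat.gcd_dvd_right n i)⟩

/-- The functions on `ZMod n` having a period that properly divides `i` and divides `n`. -/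
def properlyPeriodic (n i : ℕ) (A : Type*) : Set (ZMod n → A) :=
  {w | ∃ d, d ∣ n ∧ d ∣ i ∧ d < i ∧ Periodic w (d : ZMod n)}

/-- The functions on `ZMod n` that differ in one place from one in `properlyPeriodic n i A`. -/
def nearlyPeriodic (n i : ℕ) (A : Type*) [AddCommGroup A] : Set (ZMod n → A) :=
  {u | ∃ w ∈ properlyPeriodic n i A, ∃ (p : ZMod n) (c : A), c ≠ 0 ∧ u = w + Pi.single p c}

/-- The bounds `j < i` and `2 * i ≤ n` make i - j, 2j and i + j nonzero modulo n, as the structure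
result requires. -/
theorem numJumps_eq_two_and_iff [NeZero n] [AddCommGroup A] [Fintype A] [DecidableEq A] {i : ℕ}
    (hi : 1 ≤ i) (hn : 2 * i ≤ n) (u : ZMod n → A) :
    (numJumps u (i : ZMod n) = 2 ∧ ∀ j : ℕ, 1 ≤ j → j < i → numJumps u (j : ZMod n) ≠ 2) ↔
      numJumps u (i : ZMod n) = 2 ∧ u ∉ nearlyPeriodic n i A := by
  refine and_congr_right fun h2 => ⟨?_, ?_⟩
  · rintro h ⟨w, ⟨d, hdn, hdi, hlt, hw⟩, p, c, hc, rfl⟩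
    have hd : 1 ≤ d := Nat.pos_of_dvd_of_pos hdi hi
    exact h d hd hlt (numJumps_add_single (ZMod.natCast_ne_zero_of_lt hd (by omega)) hw p hc)
  · intro h j hj hji hJ
    apply h
    obtain ⟨w, p, c, hc, hwi, hwj, rfl⟩ := exists_periodic_of_two_jumps
      (ZMod.natCast_ne_zero_of_lt hi (by omega)) (ZMod.natCast_ne_zero_of_lt hj (by omega))
      (fun h => absurd (sub_eq_zero.2 h) (by
        rw [← Nat.cast_sub hji.le]
        exact ZMod.natCast_ne_zero_of_lt (by omega) (by omega)))
      (by rw [← Nat.cast_add]; exact ZMod.natCast_ne_zero_of_lt (by omega) (by omega))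
      (by rw [← Nat.cast_add]; exact ZMod.natCast_ne_zero_of_lt (by omega) (by omega)) h2 hJ
    refine ⟨w, ⟨Nat.gcd n (Nat.gcd i j), Nat.gcd_dvd_left _ _,
      (Nat.gcd_dvd_right _ _).trans (Nat.gcd_dvd_left _ _), ?_,
      periodic_gcd (periodic_natCast_self w) (periodic_gcd hwi hwj)⟩, p, c, hc, rfl⟩
    exact (Nat.le_of_dvd hj ((Nat.gcd_dvd_right _ _).trans (Nat.gcd_dvd_right _ _))).trans_lt hji

theorem numJumps_of_mem_nearlyPeriodic [NeZero n] [AddCommGroup A] [DecidableEq A] {i : ℕ}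
    (hi : 1 ≤ i) (hn : 2 * i ≤ n) {u : ZMod n → A} (hu : u ∈ nearlyPeriodic n i A) :
    numJumps u (i : ZMod n) = 2 := by
  obtain ⟨w, ⟨d, -, hdi, -, hw⟩, p, c, hc, rfl⟩ := hu
  exact numJumps_add_single (ZMod.natCast_ne_zero_of_lt hi (by omega))
    (periodic_natCast_of_dvd hdi hw) p hc

theorem ncard_nearlyPeriodic [NeZero n] [AddCommGroup A] [Fintype A] {i : ℕ}
    (hi : 1 ≤ i) (hn : 2 * i ≤ n) :
    (nearlyPeriodic n i A).ncard = (properlyPeriodic n i A).ncard * (n * (Fintype.card A - 1)) := by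
  classical
  have himage : nearlyPeriodic n i A = (fun x : (ZMod n → A) × ZMod n × A =>
      x.1 + Pi.single x.2.1 x.2.2) '' (properlyPeriodic n i A ×ˢ Set.univ ×ˢ {0}ᶜ) := by
    ext u
    constructor
    · rintro ⟨w, hw, p, c, hc, rfl⟩
      exact ⟨(w, p, c), ⟨hw, trivial, hc⟩, rfl⟩
    · rintro ⟨⟨w, p, c⟩, ⟨hw, -, hc⟩, rfl⟩
      exact ⟨w, hw, p, c, hc, rfl⟩
  rw [himage, Set.InjOn.ncard_image, Set.ncard_prod, Set.ncard_prod, Set.ncard_univ,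
    Set.ncard_compl, Set.ncard_singleton, Nat.card_zmod, Nat.card_eq_fintype_card]
  rintro ⟨w, p, c⟩ ⟨⟨d, -, hdi, hd, hw⟩, -, hc⟩ ⟨w', p', c'⟩ ⟨⟨d', -, hdi', hd', hw'⟩, -, -⟩ h
  have h0 : 0 < d := Nat.pos_of_dvd_of_pos hdi hi
  have h0' : 0 < d' := Nat.pos_of_dvd_of_pos hdi' hi
  have key : ∀ {m : ℕ}, m < i → (m : ZMod n) ≠ i := fun {m} hm h => by
    refine ZMod.natCast_ne_zero_of_lt (n := n) (m := i - m) (by omega) (by omega) ?_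
    rw [Nat.cast_sub hm.le, h, sub_self]
  -- Distinct proper divisors of `i` therefore have sum strictly between 0 and `i`, which supplies
  -- `hdd`.
  have half : ∀ {e : ℕ}, e ∣ i → e < i → 2 * e ≤ i := by
    rintro e ⟨q, rfl⟩ he
    have : 2 ≤ q := by
      by_contra! hq
      interval_cases q <;> omega
    nlinarith
  have hh := half hdi hd
  have hh' := half hdi' hd'
  have hdd : (d : ZMod n) = d' ∨ (d : ZMod n) + d' ≠ 0 ∧ (d : ZMod n) + d' ≠ i := by
    rcases eq_or_ne d d' with rfl | hne
    · exact Or.inl rfl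
    · rw [← Nat.cast_add]
      exact Or.inr ⟨ZMod.natCast_ne_zero_of_lt (by omega) (by omega), key (by omega)⟩
  obtain ⟨rfl, rfl, rfl⟩ := add_single_injective (ZMod.natCast_ne_zero_of_lt hi (by omega))
    (ZMod.natCast_ne_zero_of_lt h0 (by omega)) (key hd)
    (ZMod.natCast_ne_zero_of_lt h0' (by omega)) (key hd') hdd
    (periodic_natCast_of_dvd hdi hw) (periodic_natCast_of_dvd hdi' hw') hw hw' hc h
  rfl

/-! ### Periodic functions as functions on a quotient -/

theorem comp_castHom_injective {d : ℕ} (h : d ∣ n) :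
    Injective fun z : ZMod d → A => z ∘ ZMod.castHom h (ZMod d) :=
  (ZMod.castHom_surjective h).injective_comp_right

theorem periodic_comp_castHom_iff {d : ℕ} (h : d ∣ n) (z : ZMod d → A) (c : ℕ) :
    Periodic (z ∘ ZMod.castHom h (ZMod d)) (c : ZMod n) ↔ Periodic z (c : ZMod d) := by
  constructor
  · intro hz t
    obtain ⟨t, rfl⟩ := ZMod.castHom_surjective h t
    simpa only [comp_apply, map_add, map_natCast] using hz t
  · intro hz t
    simpa only [comp_apply, map_add, map_natCast] using hz (ZMod.castHom h (ZMod d) t)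

theorem exists_comp_castHom [NeZero n] {d : ℕ} (h : d ∣ n) {w : ZMod n → A}
    (hw : Periodic w (d : ZMod n)) : ∃ z : ZMod d → A, z ∘ ZMod.castHom h (ZMod d) = w := by
  have : NeZero d := ⟨fun h0 => NeZero.ne n (by simpa [h0] using h)⟩
  refine ⟨fun x => w (x.val : ZMod n), funext fun t => ?_⟩
  have hq := hw.nsmul (t.val / d) ((t.val % d : ℕ) : ZMod n)
  rw [nsmul_eq_mul, ← Nat.cast_mul, ← Nat.cast_add, mul_comm, Nat.mod_add_div,
    ZMod.natCast_zmod_val] at hq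
  rw [comp_apply, hq, ← ZMod.natCast_zmod_val t, map_natCast, ZMod.val_natCast,
    ZMod.natCast_zmod_val]

theorem ncard_periodic [NeZero n] [Finite A] (i : ℕ) :
    {w : ZMod n → A | Periodic w (i : ZMod n)}.ncard = Nat.card A ^ Nat.gcd n i := by
  have hd := Nat.gcd_dvd_left n i
  have : NeZero (Nat.gcd n i) := ⟨Nat.gcd_ne_zero_left (NeZero.ne n)⟩
  have himage : {w : ZMod n → A | Periodic w (i : ZMod n)} =
      (fun z : ZMod (Nat.gcd n i) → A => z ∘ ZMod.castHom hd (ZMod (Nat.gcd n i))) '' Set.univ := by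
    ext w
    rw [Set.mem_ofPred_eq, periodic_gcd_iff, Set.image_univ]
    constructor
    · exact fun hw => exists_comp_castHom hd hw
    · rintro ⟨z, rfl⟩
      exact (periodic_comp_castHom_iff hd z _).2 (periodic_natCast_self z)
  rw [himage, Set.ncard_image_of_injective _ (comp_castHom_injective hd), Set.ncard_univ,
    Nat.card_fun, Nat.card_zmod]

/-- Period `i` implies period gcd(n, i), which is smaller than `i` when `i` does not divide `n`. -/
theorem properlyPeriodic_of_not_dvd {i : ℕ} (hi : 1 ≤ i) (h : ¬ i ∣ n) :
    properlyPeriodic n i A = {w | Periodic w (i : ZMod n)} := by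
  ext w
  constructor
  · rintro ⟨d, -, hdi, -, hw⟩
    exact periodic_natCast_of_dvd hdi hw
  · intro hw
    refine ⟨Nat.gcd n i, Nat.gcd_dvd_left _ _, Nat.gcd_dvd_right _ _, ?_, periodic_gcd_iff.1 hw⟩
    refine lt_of_le_of_ne (Nat.le_of_dvd hi (Nat.gcd_dvd_right _ _)) fun h1 => h ?_
    exact h1 ▸ Nat.gcd_dvd_left n i

theorem ncard_properlyPeriodic_of_dvd [NeZero n] {i : ℕ} (h : i ∣ n) :
    (properlyPeriodic n i A).ncard = (properlyPeriodic i i A).ncard := by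
  rw [← Set.ncard_image_of_injective (properlyPeriodic i i A) (comp_castHom_injective h)]
  congr 1
  ext w
  constructor
  · rintro ⟨d, -, hdi, hlt, hw⟩
    obtain ⟨z, rfl⟩ := exists_comp_castHom h (periodic_natCast_of_dvd hdi hw)
    exact ⟨z, ⟨d, hdi, hdi, hlt, (periodic_comp_castHom_iff h z d).1 hw⟩, rfl⟩
  · rintro ⟨z, ⟨d, -, hdi, hlt, hz⟩, rfl⟩
    exact ⟨d, hdi.trans h, hdi, hlt, (periodic_comp_castHom_iff h z d).2 hz⟩

/-- Count of the functions on `ZMod n` with two jumps along `i` and not along any smaller `j`. -/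
theorem two_mul_ncard_two_jumps_new [NeZero n] [AddCommGroup A] [Fintype A] [DecidableEq A] {i : ℕ}
    (hi : 1 ≤ i) (hn : 2 * i ≤ n) :
    2 * {u : ZMod n → A | numJumps u (i : ZMod n) = 2 ∧
        ∀ j : ℕ, 1 ≤ j → j < i → numJumps u (j : ZMod n) ≠ 2}.ncard +
      2 * ((properlyPeriodic n i A).ncard * (n * (Fintype.card A - 1))) =
    n * ((n / Nat.gcd n i - 1) * (Fintype.card A ^ Nat.gcd n i * (Fintype.card A - 1))) := by
  classical
  have hall := two_mul_card_two_jumps (A := A) (i : ZMod n)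
  have hper := ncard_periodic (n := n) (A := A) i
  rw [Set.ncard_eq_toFinset_card', Set.toFinset_ofPred, Nat.card_eq_fintype_card] at hper
  rw [ZMod.card, ZMod.addOrderOf_coe _ (NeZero.ne n), hper] at hall
  rw [← hall, ← ncard_nearlyPeriodic hi hn, ← mul_add]
  congr 1
  have hsplit : {u : ZMod n → A | numJumps u (i : ZMod n) = 2 ∧
      ∀ j : ℕ, 1 ≤ j → j < i → numJumps u (j : ZMod n) ≠ 2} =
      {u : ZMod n → A | numJumps u (i : ZMod n) = 2} \ nearlyPeriodic n i A := by
    ext u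
    exact numJumps_eq_two_and_iff hi hn u
  have hsub : nearlyPeriodic n i A ⊆ {u : ZMod n → A | numJumps u (i : ZMod n) = 2} :=
    fun u hu => numJumps_of_mem_nearlyPeriodic hi hn hu
  rw [hsplit, Set.ncard_sdiff_add_ncard_of_subset hsub, Set.ncard_eq_toFinset_card',
    Set.toFinset_ofPred]

end Cyclic

/-! ### Transfer to words and the final formula -/

namespace Word

/-- Words of length `n` as functions on `ZMod n`. -/
def cyclicEquiv (k n : ℕ) [NeZero n] : Word k n ≃ (ZMod n → Fin k) where
  toFun u t := u ⟨t.val, ZMod.val_lt t⟩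
  invFun w t := w (t.val : ZMod n)
  left_inv u := by
    funext t
    simp only [ZMod.val_natCast, Nat.mod_eq_of_lt t.isLt]
  right_inv w := by
    funext t
    simp only [ZMod.natCast_zmod_val]

variable {k n : ℕ} [NeZero n]

theorem cyclicEquiv_natCast (u : Word k n) (t : ℕ) :
    cyclicEquiv k n u (t : ZMod n) = u ⟨t % n, Nat.mod_lt _ (NeZero.pos n)⟩ := by
  simp only [cyclicEquiv, Equiv.coe_fn_mk, ZMod.val_natCast]

theorem hammingDist_shift (u : Word k n) (i : ℕ) :
    hammingDist u (u.shift i) = numJumps (cyclicEquiv k n u) (i : ZMod n) := by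
  refine Finset.card_bij (fun t _ => ((t : ℕ) : ZMod n)) ?_ ?_ ?_
  · intro t ht
    simp only [mem_filter, mem_univ, true_and] at ht ⊢
    rw [← Nat.cast_add, cyclicEquiv_natCast, cyclicEquiv_natCast]
    simpa only [shift, Nat.mod_eq_of_lt t.isLt] using ht.symm
  · intro t _ t' _ h
    have := congrArg ZMod.val h
    rw [ZMod.val_natCast, ZMod.val_natCast, Nat.mod_eq_of_lt t.isLt, Nat.mod_eq_of_lt t'.isLt]
      at this
    exact Fin.ext this
  · intro t ht
    refine ⟨⟨t.val, ZMod.val_lt t⟩, ?_, ZMod.natCast_zmod_val t⟩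
    simp only [mem_filter, mem_univ, true_and] at ht ⊢
    rw [← ZMod.natCast_zmod_val t, ← Nat.cast_add, cyclicEquiv_natCast, cyclicEquiv_natCast] at ht
    simpa only [shift, Nat.mod_eq_of_lt (ZMod.val_lt t)] using ht.symm

theorem isPower_iff (w : Word k n) :
    w.IsPower ↔ cyclicEquiv k n w ∈ properlyPeriodic n n (Fin k) := by
  have hn := NeZero.pos n
  constructor
  · rintro ⟨m, d, h, z, hm, rfl⟩
    have hd : 0 < d := Nat.pos_of_ne_zero fun h0 => by simp [h0] at h; omega
    have hdn : d ∣ n := ⟨m, by rw [h, mul_comm]⟩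
    refine ⟨d, hdn, hdn, by nlinarith, fun t => ?_⟩
    rw [← ZMod.natCast_zmod_val t, ← Nat.cast_add, cyclicEquiv_natCast, cyclicEquiv_natCast]
    simp only [comp_apply, Fin.repeat_apply]
    congr 1
    ext
    simp [Fin.modNat, Nat.mod_mod_of_dvd _ hdn]
  · rintro ⟨d, hdn, -, hlt, hw⟩
    obtain ⟨z, hz⟩ := exists_comp_castHom hdn hw
    obtain ⟨m, hm⟩ := hdn
    have hm2 : 2 ≤ m := by
      by_contra! hq
      interval_cases m <;> omega
    refine ⟨m, d, by rw [hm, mul_comm], fun t => z ((t : ℕ) : ZMod d), hm2, ?_⟩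
    funext t
    have h1 := cyclicEquiv_natCast w t
    rw [← hz, comp_apply, map_natCast] at h1
    simp only [Nat.mod_eq_of_lt t.isLt] at h1
    rw [← h1]
    simp [Fin.modNat]

theorem numNonprimitive_eq : numNonprimitive k n = (properlyPeriodic n n (Fin k)).ncard := by
  rw [numNonprimitive, ← Set.ncard_image_of_injective _ (cyclicEquiv k n).injective]
  congr 1
  ext w
  simp only [IsPrimitive, not_not, isPower_iff, Set.mem_image, Set.mem_ofPred_eq]
  exact ⟨by rintro ⟨u, hu, rfl⟩; exact hu, fun h => ⟨(cyclicEquiv k n).symm w, by simpa using h⟩⟩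

theorem numH''_eq (i : ℕ) : numH'' k n i = {u : ZMod n → Fin k | numJumps u (i : ZMod n) = 2 ∧
    ∀ j : ℕ, 1 ≤ j → j < i → numJumps u (j : ZMod n) ≠ 2}.ncard := by
  rw [numH'', ← Set.ncard_image_of_injective _ (cyclicEquiv k n).injective]
  congr 1
  ext w
  simp only [setH'', setH, Set.mem_ofPred_eq, hammingDist_shift, Set.mem_image]
  exact ⟨by rintro ⟨u, hu, rfl⟩; exact hu, fun h => ⟨(cyclicEquiv k n).symm w, by simpa using h⟩⟩

end Word

theorem lemma15 (k n i : ℕ) (hi : 1 ≤ i) (hn : 2 * i ≤ n) :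
    (numH'' k n i : ℚ) =
      if i ∣ n then
        1 / 2 * (n : ℚ) * ((k : ℚ) - 1) *
          ((k : ℚ) ^ Nat.gcd n i * ((n : ℚ) / (Nat.gcd n i : ℚ) - 1)
            - 2 * (numNonprimitive k i : ℚ))
      else
        1 / 2 * (k : ℚ) ^ Nat.gcd n i * ((k : ℚ) - 1) * (n : ℚ) *
          ((n : ℚ) / (Nat.gcd n i : ℚ) - 3) := by
  have : NeZero n := ⟨by omega⟩
  have : NeZero i := ⟨by omega⟩
  have hg : Nat.gcd n i ≠ 0 := Nat.gcd_ne_zero_left (NeZero.ne n)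
  -- The group structure on `Fin k` needs `k > 0`; over the empty alphabet both counts vanish.
  rcases Nat.eq_zero_or_pos k with rfl | hk
  · have h1 : numH'' 0 n i = 0 := by
      rw [numH'', Set.eq_empty_of_isEmpty (setH'' 0 n i), Set.ncard_empty]
    have h2 : numNonprimitive 0 i = 0 := by
      rw [numNonprimitive, Set.eq_empty_of_isEmpty {w : Word 0 i | ¬ w.IsPrimitive},
        Set.ncard_empty]
    simp [h1, h2, hg]
  have : NeZero k := ⟨by omega⟩
  have key := two_mul_ncard_two_jumps_new (A := Fin k) hi hn
  rw [← Word.numH''_eq, Fintype.card_fin] at key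
  have hL : 1 ≤ n / Nat.gcd n i :=
    Nat.div_pos (Nat.le_of_dvd (NeZero.pos n) (Nat.gcd_dvd_left _ _)) (Nat.pos_of_ne_zero hg)
  have hcast : ((n / Nat.gcd n i : ℕ) : ℚ) = (n : ℚ) / (Nat.gcd n i : ℚ) :=
    Nat.cast_div (Nat.gcd_dvd_left _ _) (by exact_mod_cast hg)
  have keyQ := congrArg (Nat.cast : ℕ → ℚ) key
  push_cast [Nat.cast_sub hL, Nat.cast_sub hk, hcast] at keyQ
  split_ifs with h
  · rw [ncard_properlyPeriodic_of_dvd h, ← Word.numNonprimitive_eq] at keyQ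
    linear_combination keyQ / 2
  · rw [properlyPeriodic_of_not_dvd hi h, ncard_periodic, Nat.card_fin] at keyQ
    push_cast at keyQ
    linear_combination keyQ / 2
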